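/- Let $n\ge 1$, $X\subseteq\mathbb R^n$, $S\subseteq\mathbb R^m$, and let $H\colon X\times S\to\mathbb R^n$ be differentiable; $H'_x$ denotes its Jacobian with respect to $x$. All inequalities and absolute values of vectors, matrices and 3-tensors are meant componentwise. For 3-tensors, $(\mathcal Tv)_{ij}=\sum_k\mathcal T_{ijk}v_k$, $(C\mathcal T)_{ijk}=\sum_l C_{il}\mathcal T_{ljk}$, $(\mathcal TB)_{ijk}=\sum_l\mathcal T_{ijl}B_{lk}$ and $v^T\mathcal Tv=(\mathcal Tv)v$. A slope of a (vector- or matrix-valued) function $F$ with center $y$ at $y'$ is a matrix (or 3-tensor) $F[y,y']$ with $F(y')-F(y)=F[y,y'](y'-y)$. Let $\mathbf x\subseteq X$ and $\mathbf s\subseteq S$ be closed boxes, $z\in\mathbf x$, $p\in\mathbf s$, and let $\hat x\colon\mathbb R^m\to\mathbb R^n$ be continuously differentiable with $\hat x(p)=z$ and $\hat x(t)\in\mathbf x$ for all $t\in\mathbf s$. Put $g(t)=(\hat x(t),t)$. Let $C\in\mathbb R^{n\times n}$, and let $\bar b\in\mathbb R^n$, $B_0\in\mathbb R^{n\times n}$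 satisfy $$\bar b\ge|CH(z,p)|,\qquad B_0\ge|CH'_x(z,p)-\mathbb 1|.$$ Fix a parameter value $s\in\mathbf s$ and suppose that $\hat x:=\hat x(s)\in\operatorname{int}(\mathbf x)$. Fix slopes $\hat x[p,s]$ of $\hat x(\cdot)$, $H[g(p),g(s)]$ of $H$ and $H'_x[g(p),g(s)]$ of $H'_x$, let $g[p,s]=\begin{pmatrix}\hat x[p,s]\\ \mathbb 1\end{pmatrix}$, and set $$G_0=|C\,H[g(p),g(s)]|\,|g[p,s]|,\qquad A=|C\,H'_x[g(p),g(s)]|\,|g[p,s]|,$$ $$\bar{\mathfrak b}(s)=\bar b+G_0|s-p|,\qquad \mathfrak B_0(s)=B_0+A|s-p|.$$ For each $x\in\mathbf x$ let $H_{xx}[g(s),g(s),(x,s)]\in\mathbb R^{n\times n\times n}$ be a second order slope of $H$ with respect to $x$, i.e. some slope matrix of $H$ with center $g(s)$ at $(x,s)$ has as its $x$-columns the matrix $H'_x(g(s))+H_{xx}[g(s),g(s),(x,s)]\,(x-\hat x)$. Let $\mathfrak B(x,s)\ge|C\,H_{xx}[g(s),g(s),(x,s)]|$ and $\mathfrak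 B(s)\ge\mathfrak B(x,s)$ for all $x\in\mathbf x$. Let $0<v\in\mathbb R^n$ and set $\mathfrak w(s)=(\mathbb 1-\mathfrak B_0(s))v$ and $\mathfrak a(s)=v^T\mathfrak B(s)v$. Suppose that for all $j=1,\dots,n$ one has $\mathfrak w_j(s)>0$, $\mathfrak a_j(s)\ne 0$ and $$D_j(s)=\mathfrak w_j(s)^2-4\,\mathfrak a_j(s)\,\bar{\mathfrak b}_j(s)>0,$$ and define $$\lambda^e_j(s)=\frac{\mathfrak w_j(s)+\sqrt{D_j(s)}}{2\mathfrak a_j(s)},\quad \lambda^i_j(s)=\frac{\bar{\mathfrak b}_j(s)}{\mathfrak a_j(s)\lambda^e_j(s)},\quad \lambda^e_s=\min_j\lambda^e_j(s),\quad \lambda^i_s=\max_j\lambda^i_j(s).$$ Suppose that $\lambda^e_s>\lambda^i_s$ and that $[\hat x_j-\lambda^i_sv_j,\ \hat x_j+\lambda^i_sv_j]\subseteq\mathbf x_j$ for all $j$. Then $H(\cdot,s)$ has at least one zero in the inclusion box $\mathbf R^i_s=[\hat x-\lambda^i_sv,\ \hat x+\lambda^i_sv]$, and every zero of $H(\cdot,s)$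 in the interior of the exclusion box $\mathbf R^e_s=[\hat x-\lambda^e_sv,\ \hat x+\lambda^e_sv]\cap\mathbf x$ lies in $\mathbf R^i_s$. -/

import Mathlib

open scoped Matrix

noncomputable section

namespace IncExc

/-- Real third order tensors with the index sets `ι`, `κ`, `τ`. As functions they carry the
componentwise order and the componentwise absolute value. -/
abbrev Tensor (ι κ τ : Type) : Type := ι → κ → τ → ℝ

/-- `(T v) i j = ∑ k, T i j k * v k`. -/
def Tensor.mulVec {ι κ τ : Type} [Fintype τ] (T : Tensor ι κ τ) (v : τ → ℝ) : Matrix ι κ ℝ :=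
  Matrix.of fun i j => ∑ k, T i j k * v k

/-- `(C T) i j k = ∑ l, C i l * T l j k`. -/
def Tensor.matMul {ι ι' κ τ : Type} [Fintype ι] (C : Matrix ι' ι ℝ) (T : Tensor ι κ τ) :
    Tensor ι' κ τ :=
  fun i j k => ∑ l, C i l * T l j k

/-- `(T B) i j k = ∑ l, T i j l * B l k`. -/
def Tensor.mulMat {ι κ τ τ' : Type} [Fintype τ] (T : Tensor ι κ τ) (B : Matrix τ τ' ℝ) :
    Tensor ι κ τ' :=
  fun i j k => ∑ l, T i j l * B l k

/-- `vᵀ T v = (T v) v`. -/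
def Tensor.quad {ι κ : Type} [Fintype κ] (T : Tensor ι κ κ) (v : κ → ℝ) : ι → ℝ :=
  T.mulVec v *ᵥ v

/-- The componentwise absolute value of a matrix. -/
def absMat {ι κ : Type} (M : Matrix ι κ ℝ) : Matrix ι κ ℝ := M.map fun t => |t|

/-- `M` is a slope matrix for `F` with center `z` at `y`: `F y - F z = M (y - z)`. -/
def IsSlope {ι κ : Type} [Fintype ι] (F : (ι → ℝ) → κ → ℝ) (z y : ι → ℝ) (M : Matrix κ ι ℝ) :
    Prop :=
  F y - F z = M *ᵥ (y - z)

/-- `T` is a slope tensor for the matrix-valued function `F` with center `z` at `y`: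
`F y - F z = T (y - z)`. -/
def IsTensorSlope {ι κ κ' : Type} [Fintype ι] (F : (ι → ℝ) → Matrix κ κ' ℝ) (z y : ι → ℝ)
    (T : Tensor κ κ' ι) : Prop :=
  F y - F z = T.mulVec (y - z)

variable {n m : ℕ}

/-- The point `(x, s)` of `ℝⁿ × ℝᵐ = ℝⁿ⁺ᵐ`. -/
def pt (x : Fin n → ℝ) (s : Fin m → ℝ) : Fin n ⊕ Fin m → ℝ := Sum.elim x s

/-- The subset `X × S` of `ℝⁿ⁺ᵐ`. -/
def dom (X : Set (Fin n → ℝ)) (S : Set (Fin m → ℝ)) : Set (Fin n ⊕ Fin m → ℝ) :=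
  {y | (fun i => y (Sum.inl i)) ∈ X ∧ (fun k => y (Sum.inr k)) ∈ S}

/-- The columns of an `n × (n + m)` matrix that belong to the variables `x`. -/
def xCols (M : Matrix (Fin n) (Fin n ⊕ Fin m) ℝ) : Matrix (Fin n) (Fin n) ℝ :=
  M.submatrix id Sum.inl

/-- The Jacobian `H'ₓ(y)` with respect to `x`: the `x`-columns of the Jacobian matrix of `H`,
the derivative being taken relative to the domain `D` of `H`. -/
def jacX (H : (Fin n ⊕ Fin m → ℝ) → Fin n → ℝ) (D : Set (Fin n ⊕ Fin m → ℝ))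
    (y : Fin n ⊕ Fin m → ℝ) : Matrix (Fin n) (Fin n) ℝ :=
  xCols (LinearMap.toMatrix' (fderivWithin ℝ H D y : (Fin n ⊕ Fin m → ℝ) →ₗ[ℝ] (Fin n → ℝ)))

/-- `T` is a second order slope of `H` with respect to `x`, with double center `(c, s)`, at
`(x, s)`: some slope matrix of `H` with center `(c, s)` at `(x, s)` has the `x`-columns
`H'ₓ(c, s) + T (x - c)`. -/
def IsSecondSlopeX (H : (Fin n ⊕ Fin m → ℝ) → Fin n → ℝ) (D : Set (Fin n ⊕ Fin m → ℝ))
    (s : Fin m → ℝ) (c x : Fin n → ℝ) (T : Tensor (Fin n) (Fin n) (Fin n)) : Prop :=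
  ∃ M : Matrix (Fin n) (Fin n ⊕ Fin m) ℝ, IsSlope H (pt c s) (pt x s) M ∧
    xCols M = jacX H D (pt c s) + T.mulVec (x - c)

/-- The slope matrix of `g(s) = (x̂(s), s)` obtained from a slope matrix of `x̂`: the identity is
stacked below it. -/
def gSlope (Sx : Matrix (Fin n) (Fin m) ℝ) : Matrix (Fin n ⊕ Fin m) (Fin m) ℝ :=
  Matrix.fromRows Sx 1

/-- `D_j = w_j² - 4 a_j b_j`. -/
def disc (w a b : Fin n → ℝ) (j : Fin n) : ℝ := w j ^ 2 - 4 * a j * b j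

/-- `λᵉ_j = (w_j + √D_j) / (2 a_j)`. -/
def lamE (w a b : Fin n → ℝ) (j : Fin n) : ℝ := (w j + √(disc w a b j)) / (2 * a j)

/-- `λⁱ_j = b_j / (a_j λᵉ_j)`. -/
def lamI (w a b : Fin n → ℝ) (j : Fin n) : ℝ := b j / (a j * lamE w a b j)

/-- `λᵉ = min_j λᵉ_j`. -/
def lamEMin [NeZero n] (w a b : Fin n → ℝ) : ℝ :=
  Finset.univ.inf' Finset.univ_nonempty (lamE w a b)

/-- `λⁱ = max_j λⁱ_j`. -/
def lamIMax [NeZero n] (w a b : Fin n → ℝ) : ℝ :=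
  Finset.univ.sup' Finset.univ_nonempty (lamI w a b)

end IncExc

end

open IncExc

/-! Write `c` for `xhat s` and study `K x = x - C *ᵥ H (pt x s)`. The slope expansions show that `|x
- c| ≤ t v` implies `|K x - c| j ≤ t v j + (𝔟 j - t 𝔴 j + t² 𝔞 j)`, and the bracket factors as `𝔞 j
(t - λᵉ j)(t - λⁱ j)` with `𝔞 j > 0`. Existence: `t = li` lies between the two roots for every `j`,
so `K` maps the inclusion box into itself and Brouwer gives a fixed point. It is a zero because `C`
is injective (`mulVec_eq_zero_of_abs_mul_sub_one_le`). Exclusion: a zero is fixed by `K`. With `t`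
the `v`-weighted maximum norm of `x - c`, attained at `j`, the estimate forces the quadratic to be
nonnegative at `t`; since `t < le ≤ λᵉ j`, this leaves `t ≤ λⁱ j ≤ li`. Brouwer's theorem is proved
by the volume argument of Milnor and Rogers. For a `C¹` retraction `r` onto the sphere, `x + t (r x
- x)` permutes the open ball for small `t`, so the integral of its Jacobian, a polynomial in `t`, is
constantly the volume of the ball; at `t = 1` the integrand vanishes. -/

namespace IncExc

open Metric Set MeasureTheory

/-! ### Brouwer's fixed point theorem by volume and polynomial interpolation -/

section Brouwer

variable {E : Type*} [NormedAddCommGroup E] [InnerProductSpace ℝ E] [FiniteDimensional ℝ E]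

/-- The polynomial `t ↦ det (1 + t A)` has degree at most `dim E`, so its value at `1` is obtained
by interpolation from its values at `dim E + 1` nodes in any interval `(0, ε)`. -/
theorem exists_det_one_add_interpolation (E : Type*) [NormedAddCommGroup E]
    [InnerProductSpace ℝ E] [FiniteDimensional ℝ E] {ε : ℝ} (hε : 0 < ε) :
    ∃ (N : ℕ) (t c : Fin N → ℝ), (∀ i, 0 < t i ∧ t i < ε) ∧
      ∀ A : E →L[ℝ] E, (1 + A).det = ∑ i, c i * (1 + t i • A).det := by
  classical
  let d := Module.finrank ℝ E
  -- The shift by 1 and the denominator `d + 2` keep all `d + 1` nodes strictly between `0` and `ε`.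
  let t : Fin (d + 1) → ℝ := fun i => ε * ((i : ℝ) + 1) / (d + 2)
  have ht : Function.Injective t := by
    intro i j hij
    have hd : (0 : ℝ) < d + 2 := by positivity
    simp only [t] at hij
    field_simp at hij
    exact Fin.ext (by exact_mod_cast add_right_cancel hij)
  refine ⟨d + 1, t, fun i => (Lagrange.basis Finset.univ t i).eval 1, fun i => ⟨?_, ?_⟩, ?_⟩
  · positivity
  · have hi : (i : ℝ) + 1 ≤ d + 1 := by exact_mod_cast i.2
    simp only [t]
    rw [div_lt_iff₀ (by positivity)]
    exact mul_lt_mul_of_pos_left (by linarith) hε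
  · intro A
    let bs := Module.finBasis ℝ E
    let M := LinearMap.toMatrix bs bs (A : E →ₗ[ℝ] E)
    let P : Polynomial ℝ :=
      ((Polynomial.X : Polynomial ℝ) • M.map Polynomial.C + (1 : Matrix _ _ ℝ).map Polynomial.C).det
    have hP : ∀ u : ℝ, P.eval u = (1 + u • A).det := by
      intro u
      have h1 : (1 + u • A).det = (1 + u • M).det := by
        change LinearMap.det ((1 : E →ₗ[ℝ] E) + u • (A : E →ₗ[ℝ] E)) = _
        rw [← LinearMap.det_toMatrix bs, map_add, map_smul, LinearMap.toMatrix_one]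
      rw [h1, ← Polynomial.coe_evalRingHom, RingHom.map_det]
      congr 1
      ext i j
      by_cases hij : i = j <;>
        simp [Matrix.add_apply, M, hij, add_comm, mul_comm u]
    have hdeg : P.degree < (Finset.univ : Finset (Fin (d + 1))).card := by
      have h := Polynomial.natDegree_det_X_add_C_le M 1
      rw [Fintype.card_fin] at h
      refine lt_of_le_of_lt (Polynomial.degree_le_of_natDegree_le h) ?_
      simp only [Finset.card_univ, Fintype.card_fin]
      exact_mod_cast Nat.lt_succ_self d
    have hI := congrArg (Polynomial.eval 1) (Lagrange.eq_interpolate ht.injOn hdeg)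
    rw [hP, one_smul, Lagrange.interpolate_apply, Polynomial.eval_finsetSum] at hI
    rw [hI]
    refine Finset.sum_congr rfl fun i _ => ?_
    rw [Polynomial.eval_mul, Polynomial.eval_C, hP, mul_comm]

/-- A small perturbation of the identity that fixes the unit sphere and is part of a linear homotopy
inside the unit ball is injective on the open unit ball and maps it onto itself. -/
theorem injOn_and_image_ball_eq {g : E → E} {K : NNReal} {t : ℝ}
    (hg : LipschitzOnWith K g (closedBall 0 1)) (ht0 : 0 < t) (ht1 : t < 1) (htK : t * K < 1)
    (hball : ∀ x ∈ closedBall (0 : E) 1, ‖x + g x‖ ≤ 1) (hsph : ∀ x ∈ sphere (0 : E) 1, g x = 0) :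
    InjOn (fun x => x + t • g x) (ball 0 1) ∧ (fun x => x + t • g x) '' ball 0 1 = ball 0 1 := by
  set f : E → E := fun x => x + t • g x with hf
  have happ : ApproximatesLinearOn f ((ContinuousLinearEquiv.refl ℝ E : E ≃L[ℝ] E) : E →L[ℝ] E)
      (ball 0 1) (t.toNNReal * K) := by
    intro x hx y hy
    have h := hg.norm_sub_le (ball_subset_closedBall hx) (ball_subset_closedBall hy)
    have : f x - f y - (ContinuousLinearEquiv.refl ℝ E : E →L[ℝ] E) (x - y)
        = t • (g x - g y) := by
      simp only [hf, ContinuousLinearEquiv.coe_refl, ContinuousLinearMap.coe_id', id_eq, smul_sub]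
      abel
    rw [this, norm_smul, Real.norm_of_nonneg ht0.le, NNReal.coe_mul, Real.coe_toNNReal _ ht0.le,
      mul_assoc]
    gcongr
  have hc : Subsingleton E ∨ t.toNNReal * K <
      ‖((ContinuousLinearEquiv.refl ℝ E).symm : E →L[ℝ] E)‖₊⁻¹ := by
    rcases subsingleton_or_nontrivial E with h | h
    · exact Or.inl h
    · right
      rw [← NNReal.coe_lt_coe]
      simp [ht0.le, htK]
  have hmaps : MapsTo f (ball 0 1) (ball 0 1) := by
    intro x hx
    rw [mem_ball_zero_iff] at hx ⊢
    have h := hball x (mem_closedBall_zero_iff.2 hx.le)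
    have hfx : f x = (1 - t) • x + t • (x + g x) := by
      simp only [hf, sub_smul, one_smul, smul_add]; abel
    calc ‖f x‖ ≤ ‖(1 - t) • x‖ + ‖t • (x + g x)‖ := by rw [hfx]; exact norm_add_le _ _
      _ = (1 - t) * ‖x‖ + t * ‖x + g x‖ := by
        rw [norm_smul, norm_smul, Real.norm_of_nonneg ht0.le, Real.norm_of_nonneg (by linarith)]
      _ < 1 := by nlinarith
  refine ⟨happ.injOn hc, Subset.antisymm hmaps.image_subset ?_⟩
  have hcont : ContinuousOn f (closedBall 0 1) :=
    continuousOn_id.add (hg.continuousOn.const_smul t)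
  have hclosed : IsClosed (f '' closedBall 0 1) :=
    ((isCompact_closedBall 0 1).image_of_continuousOn hcont).isClosed
  -- Connectedness: the image of the open ball is open, nonempty and relatively closed in the ball.
  -- For closedness, a limit value is attained on the closed ball, and not on the sphere, whose
  -- points are fixed.
  refine (convex_ball (0 : E) 1).isPreconnected.subset_of_closure_inter_subset ?_ ?_ ?_
  · refine happ.open_image (ContinuousLinearEquiv.toNonlinearRightInverse _) isOpen_ball ?_
    exact hc
  · exact ⟨f 0, hmaps (mem_ball_self one_pos), mem_image_of_mem f (mem_ball_self one_pos)⟩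
  · rintro y ⟨hy, hyb⟩
    obtain ⟨x, hx, rfl⟩ :=
      closure_minimal (image_mono ball_subset_closedBall) hclosed hy
    refine mem_image_of_mem f ?_
    rw [mem_closedBall_zero_iff] at hx
    rw [mem_ball_zero_iff] at hyb ⊢
    refine lt_of_le_of_ne hx fun h => ?_
    have : f x = x := by simp [hf, hsph x (mem_sphere_zero_iff_norm.2 h)]
    rw [this, h] at hyb
    exact lt_irrefl _ hyb

/-- The derivative of a map into the unit sphere is singular. -/
theorem det_fderiv_eq_zero_of_norm_eq_one {r : E → E} {x : E} (hr : DifferentiableAt ℝ r x)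
    (h1 : ∀ᶠ y in nhds x, ‖r y‖ = 1) : (fderiv ℝ r x).det = 0 := by
  by_contra hdet
  have hsurj : Function.Surjective (fderiv ℝ r x) :=
    (LinearMap.equivOfDetNeZero (fderiv ℝ r x : E →ₗ[ℝ] E) hdet).surjective
  -- Differentiating `⟨r, r⟩ = 1` in a direction `h` with `r' h = r x` gives `2 ‖r x‖² = 0`.
  obtain ⟨h, hh⟩ := hsurj (r x)
  have hd := (hr.hasFDerivAt.inner ℝ hr.hasFDerivAt)
  have hc : HasFDerivAt (fun y => inner ℝ (r y) (r y)) (0 : E →L[ℝ] ℝ) x := by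
    refine (hasFDerivAt_const (1 : ℝ) x).congr_of_eventuallyEq ?_
    filter_upwards [h1] with y hy
    rw [real_inner_self_eq_norm_sq, hy, one_pow]
  have := congrArg (fun L : E →L[ℝ] ℝ => L h) (hd.unique hc)
  simp [hh, h1.self_of_nhds] at this

/-- There is no continuously differentiable retraction of the closed unit ball onto the sphere. -/
theorem no_contDiffOn_retraction {U : Set E} (hU : IsOpen U) (hBU : closedBall 0 1 ⊆ U)
    {r : E → E} (hr : ContDiffOn ℝ 1 r U) (h1 : ∀ x ∈ closedBall (0 : E) 1, ‖r x‖ = 1)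
    (hfix : ∀ x ∈ sphere (0 : E) 1, r x = x) : False := by
  let _ : MeasurableSpace E := borel E
  have _ : BorelSpace E := ⟨rfl⟩
  let G : E → E →L[ℝ] E := fun x => fderiv ℝ r x - 1
  have hdiff : ∀ x ∈ closedBall (0 : E) 1, DifferentiableAt ℝ r x := fun x hx =>
    (hr.differentiableOn one_ne_zero).differentiableAt (hU.mem_nhds (hBU hx))
  have hGd : ∀ x ∈ closedBall (0 : E) 1, HasFDerivAt (fun y => r y - y) (G x) x := fun x hx =>
    (hdiff x hx).hasFDerivAt.sub (hasFDerivAt_id x)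
  have hGc : ContinuousOn G (closedBall 0 1) :=
    ((hr.continuousOn_fderiv_of_isOpen hU le_rfl).mono hBU).sub continuousOn_const
  obtain ⟨K, hK⟩ := (isCompact_closedBall (0 : E) 1).exists_bound_of_continuousOn hGc
  have hK0 : 0 ≤ K := (norm_nonneg _).trans (hK 0 (mem_closedBall_self zero_le_one))
  have hlip : LipschitzOnWith K.toNNReal (fun y => r y - y) (closedBall 0 1) := by
    refine (convex_closedBall (0 : E) 1).lipschitzOnWith_of_nnnorm_hasFDerivWithin_le
      (fun x hx => (hGd x hx).hasFDerivWithinAt) fun x hx => ?_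
    rw [← NNReal.coe_le_coe, Real.coe_toNNReal _ hK0]
    exact hK x hx
  obtain ⟨δ, hδ, hdet⟩ : ∃ δ > 0, ∀ A : E →L[ℝ] E, ‖A‖ < δ → 0 < (1 + A).det := by
    have hc : Continuous fun A : E →L[ℝ] E => (1 + A).det :=
      ContinuousLinearMap.continuous_det.comp (continuous_const.add continuous_id)
    have h0 : 0 < ((1 : E →L[ℝ] E) + 0).det := by
      rw [add_zero]
      change 0 < LinearMap.det (1 : E →ₗ[ℝ] E)
      simp
    obtain ⟨δ, hδ, h⟩ := Metric.eventually_nhds_iff.1 (hc.continuousAt.eventually_const_lt h0)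
    exact ⟨δ, hδ, fun A hA => h (by simpa using hA)⟩
  -- The bound on `t` gives both injectivity (`t K < 1`) and a positive determinant (`t K < δ`), so
  -- the change of variables formula needs no absolute value.
  have hvol : ∀ t : ℝ, 0 < t → t < min 1 (min 1 δ / (K + 1)) →
      ∫ x in ball (0 : E) 1, (1 + t • G x).det = volume.real (ball (0 : E) 1) := by
    intro t ht0 ht
    obtain ⟨ht1, ht2⟩ := lt_min_iff.1 ht
    rw [lt_div_iff₀ (by positivity)] at ht2
    obtain ⟨ht3, ht4⟩ := lt_min_iff.1 ht2
    have htK : t * K < min 1 δ := lt_of_le_of_lt (by nlinarith) ht2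
    obtain ⟨hinj, himg⟩ := injOn_and_image_ball_eq hlip ht0 ht1
      (by rw [Real.coe_toNNReal _ hK0]; exact htK.trans_le (min_le_left _ _))
      (fun x hx => by simp [h1 x hx]) (fun x hx => by simp [hfix x hx])
    have hcv := integral_image_eq_integral_abs_det_fderiv_smul (μ := (volume : Measure E))
      (measurableSet_ball (x := (0 : E)) (ε := 1))
      (f' := fun x => 1 + t • G x)
      (fun x hx => ((hasFDerivAt_id x).add
        ((hGd x (ball_subset_closedBall hx)).const_smul t)).hasFDerivWithinAt) hinj
      (fun _ => (1 : ℝ))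
    erw [himg] at hcv
    rw [setIntegral_const, smul_eq_mul, mul_one] at hcv
    rw [hcv]
    refine setIntegral_congr_fun measurableSet_ball fun x hx => ?_
    have hpos : 0 < (1 + t • G x).det := by
      refine hdet _ ?_
      rw [norm_smul, Real.norm_of_nonneg ht0.le]
      calc t * ‖G x‖ ≤ t * K := by gcongr; exact hK x (ball_subset_closedBall hx)
        _ < δ := htK.trans_le (min_le_right _ _)
    simp only [abs_of_pos hpos, smul_eq_mul, mul_one]
  obtain ⟨N, t, c, ht, hc⟩ := exists_det_one_add_interpolation E
    (ε := min 1 (min 1 δ / (K + 1))) (by positivity)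
  have hint : ∀ u : ℝ, IntegrableOn (fun x => (1 + u • G x).det) (ball (0 : E) 1) := fun u =>
    ((ContinuousLinearMap.continuous_det.comp_continuousOn
      (continuousOn_const.add (hGc.const_smul u))).integrableOn_compact
        (isCompact_closedBall 0 1)).mono_set ball_subset_closedBall
  have hsum : ∫ x in ball (0 : E) 1, (1 + G x).det
      = (∑ i, c i) * volume.real (ball (0 : E) 1) := by
    rw [funext fun x => hc (G x),
      integral_finsetSum _ fun i _ => (hint (t i)).const_mul (c i), Finset.sum_mul]
    refine Finset.sum_congr rfl fun i _ => ?_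
    rw [integral_const_mul, hvol (t i) (ht i).1 (ht i).2]
  -- The interpolation identity at `A = 0`.
  have hc1 : ∑ i, c i = 1 := by
    have h := hc 0
    have hone : (1 : E →L[ℝ] E).det = 1 := LinearMap.det_id
    rw [add_zero, hone] at h
    rw [h]
    refine Finset.sum_congr rfl fun i _ => ?_
    rw [smul_zero, add_zero, hone, mul_one]
  have hzero : ∫ x in ball (0 : E) 1, (1 + G x).det = 0 := by
    refine setIntegral_eq_zero_of_forall_eq_zero fun x hx => ?_
    have : 1 + G x = fderiv ℝ r x := by simp [G]
    rw [this]
    refine det_fderiv_eq_zero_of_norm_eq_one (hdiff x (ball_subset_closedBall hx)) ?_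
    filter_upwards [isOpen_ball.mem_nhds hx] with y hy using h1 y (ball_subset_closedBall hy)
  rw [hzero, hc1, one_mul] at hsum
  exact (ENNReal.toReal_pos (measure_ball_pos volume (0 : E) one_pos).ne'
    measure_ball_lt_top.ne).ne hsum

/-- A continuously differentiable map of the closed unit ball into the open one has a fixed
point: otherwise following the rays from `f x` through `x` retracts the ball onto the sphere. -/
theorem exists_fixedPoint_of_contDiff {f : E → E} (hf : ContDiff ℝ 1 f)
    (hlt : ∀ x ∈ closedBall (0 : E) 1, ‖f x‖ < 1) : ∃ x ∈ closedBall (0 : E) 1, f x = x := by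
  by_contra! hne
  let u : E → E := fun x => x - f x
  let a : E → ℝ := fun x => inner ℝ x (u x)
  let q : E → ℝ := fun x => ‖u x‖ ^ 2
  -- `τ x` is the larger root of `q τ² + 2 a τ - (1 - ‖x‖²) = 0`, which says `‖x + τ u‖ = 1`; `D` is
  -- a quarter of its discriminant. On the sphere `a > 0`, hence `D > 0` and `τ = 0`.
  let D : E → ℝ := fun x => a x ^ 2 + q x * (1 - ‖x‖ ^ 2)
  let τ : E → ℝ := fun x => (-a x + √(D x)) / q x
  have hu : ContDiff ℝ 1 u := contDiff_id.sub hf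
  have ha : ContDiff ℝ 1 a := contDiff_id.inner ℝ hu
  have hq : ContDiff ℝ 1 q := hu.norm_sq ℝ
  have hD : ContDiff ℝ 1 D :=
    (ha.pow 2).add (hq.mul (contDiff_const.sub (contDiff_id.norm_sq ℝ)))
  have hqpos : ∀ x ∈ closedBall (0 : E) 1, 0 < q x := fun x hx => by
    have : u x ≠ 0 := sub_ne_zero.2 (hne x hx).symm
    positivity
  have hapos : ∀ x : E, ‖x‖ = 1 → 0 < a x := fun x hx => by
    have h1 : a x = 1 - inner ℝ x (f x) := by
      simp [a, u, inner_sub_right, hx]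
    have h2 := real_inner_le_norm x (f x)
    have h3 := hlt x (mem_closedBall_zero_iff.2 hx.le)
    rw [hx, one_mul] at h2
    linarith
  have hDpos : ∀ x ∈ closedBall (0 : E) 1, 0 < D x := fun x hx => by
    have hq0 := hqpos x hx
    rw [mem_closedBall_zero_iff] at hx
    rcases hx.lt_or_eq with h | h
    · have : 0 < 1 - ‖x‖ ^ 2 := by nlinarith [norm_nonneg x]
      positivity
    · have := hapos x h
      simp only [D, h]
      positivity
  refine no_contDiffOn_retraction (U := {x | 0 < q x} ∩ {x | 0 < D x}) (r := fun x => x + τ x • u x)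
    ((isOpen_lt continuous_const hq.continuous).inter (isOpen_lt continuous_const hD.continuous))
    (fun x hx => ⟨hqpos x hx, hDpos x hx⟩) ?_ ?_ ?_
  · refine contDiffOn_id.add (ContDiffOn.smul ?_ hu.contDiffOn)
    exact (ha.contDiffOn.neg.add (hD.contDiffOn.sqrt fun x hx => hx.2.ne')).div hq.contDiffOn
      fun x hx => hx.1.ne'
  · intro x hx
    have hq0 := hqpos x hx
    have hs := Real.sq_sqrt (hDpos x hx).le
    have hτ : τ x * q x = -a x + √(D x) := div_mul_cancel₀ _ hq0.ne'
    have hn : ‖x + τ x • u x‖ ^ 2 = ‖x‖ ^ 2 + 2 * (τ x * a x) + τ x ^ 2 * q x := by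
      rw [norm_add_sq_real, inner_smul_right, norm_smul, mul_pow, Real.norm_eq_abs, sq_abs]
    have h1 : q x * (‖x + τ x • u x‖ ^ 2 - 1) = 0 := by
      have : q x * (‖x + τ x • u x‖ ^ 2 - 1) = (τ x * q x + a x) ^ 2 - D x := by
        rw [hn]; simp only [D]; ring
      rw [this, hτ, neg_add_cancel_comm, hs, sub_self]
    have h2 : ‖x + τ x • u x‖ ^ 2 = 1 := by
      rcases mul_eq_zero.1 h1 with h | h <;> linarith
    exact (pow_eq_one_iff_of_nonneg (norm_nonneg _) two_ne_zero).1 h2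
  · intro x hx
    rw [mem_sphere_zero_iff_norm] at hx
    have : τ x = 0 := by
      simp [τ, D, hx, Real.sqrt_sq (hapos x hx).le]
    simp [this]

/-- **Brouwer's fixed point theorem** for bounded continuous self-maps of a Euclidean space. -/
theorem exists_fixedPoint_of_continuous_of_bounded {F : E → E} (hF : Continuous F) {R : ℝ}
    (hR : ∀ x, ‖F x‖ ≤ R) : ∃ x, F x = x := by
  have hR0 : 0 ≤ R := (norm_nonneg _).trans (hR 0)
  -- Rescaling by `ρ` brings the values into the ball of radius `1/2`, so an approximation closer
  -- than `1/2` still maps into the open unit ball.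
  set ρ : ℝ := 2 * (R + 1) with hρ
  have hρ0 : 0 < ρ := by positivity
  let G : E → E := fun x => ρ⁻¹ • F (ρ • x)
  have hG : Continuous G := (hF.comp (continuous_id.const_smul ρ)).const_smul ρ⁻¹
  have hGle : ∀ x, ‖G x‖ ≤ 1 / 2 := fun x => by
    rw [norm_smul, Real.norm_of_nonneg (by positivity), inv_mul_le_iff₀ hρ0]
    linarith [hR (ρ • x)]
  suffices ∃ x, G x = x by
    obtain ⟨x, hx⟩ := this
    refine ⟨ρ • x, ?_⟩
    conv_rhs => rw [← hx]
    simp only [G, smul_inv_smul₀ hρ0.ne']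
  by_contra! hne
  -- The least displacement of `G` on the ball is positive; a fixed point of a smooth map closer to
  -- `G` than that contradicts minimality.
  obtain ⟨y, -, hy⟩ := (isCompact_closedBall (0 : E) 1).exists_isMinOn
    ⟨0, mem_closedBall_self zero_le_one⟩ (continuous_id.dist hG).continuousOn
  have hδ : 0 < dist y (G y) := dist_pos.2 (hne y).symm
  obtain ⟨f, hf, hfG, -⟩ := hG.exists_contDiff_approx 1 (ε := fun _ => min (1 / 2) (dist y (G y)))
    continuous_const fun _ => lt_min (by norm_num) hδ
  obtain ⟨x, hx, hfx⟩ := exists_fixedPoint_of_contDiff hf fun x _ => by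
    have h1 := (hfG x).trans_le (min_le_left _ _)
    rw [dist_eq_norm] at h1
    linarith [hGle x, norm_le_norm_add_norm_sub (G x) (f x), norm_sub_rev (G x) (f x)]
  have h1 := (hfG x).trans_le (min_le_right _ _)
  rw [hfx] at h1
  exact absurd (hy hx) (not_le.2 h1)

end Brouwer

/-- **Brouwer's fixed point theorem** for boxes. -/
theorem exists_fixedPoint_Icc {ι : Type*} [Fintype ι] {l u : ι → ℝ} (hlu : l ≤ u)
    {K : (ι → ℝ) → ι → ℝ} (hK : ContinuousOn K (Icc l u)) (hmaps : MapsTo K (Icc l u) (Icc l u)) :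
    ∃ x ∈ Icc l u, K x = x := by
  -- Clamping retracts the whole space onto the box, so `K ∘ c` is continuous and bounded, and its
  -- fixed points lie in the box.
  let c : (ι → ℝ) → ι → ℝ := fun x => fun i => l i ⊔ x i ⊓ u i
  have hc : Continuous c := by fun_prop
  have hcm : ∀ x, c x ∈ Icc l u := fun x => 
    ⟨fun i => le_sup_left, fun i => sup_le (hlu i) inf_le_right⟩
  have hcx : ∀ x ∈ Icc l u, c x = x := fun x hx => by
    funext i
    simp only [c, inf_eq_left.2 (hx.2 i), sup_eq_right.2 (hx.1 i)]
  have hKc : Continuous fun x => K (c x) := hK.comp_continuous hc hcm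
  let F : EuclideanSpace ℝ ι → EuclideanSpace ℝ ι := fun x => WithLp.toLp 2 (K (c x.ofLp))
  have hF : Continuous F := (PiLp.continuous_toLp 2 _).comp (hKc.comp (PiLp.continuous_ofLp 2 _))
  obtain ⟨R, hR⟩ := (isCompact_Icc (a := l) (b := u)).exists_bound_of_continuousOn
    (f := fun x => (WithLp.toLp 2 x : EuclideanSpace ℝ ι)) (PiLp.continuous_toLp 2 _).continuousOn
  obtain ⟨x, hx⟩ := exists_fixedPoint_of_continuous_of_bounded hF (R := R)
    fun x => hR _ (hmaps (hcm _))
  have hx' : K (c x.ofLp) = x.ofLp := congrArg WithLp.ofLp hx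
  have hm : x.ofLp ∈ Icc l u := hx' ▸ hmaps (hcm _)
  rw [hcx _ hm] at hx'
  exact ⟨_, hm, hx'⟩

/-! ### Componentwise estimates for matrices and tensors -/

section Componentwise

variable {ι κ τ τ' : Type}

/-- A vector is dominated by a multiple of a positive vector, with equality at some index. -/
theorem exists_abs_le_mul [Finite ι] [Nonempty ι] {v : ι → ℝ} (hv : ∀ j, 0 < v j) (y : ι → ℝ) :
    ∃ (μ : ℝ) (j : ι), 0 ≤ μ ∧ |y j| = μ * v j ∧ ∀ i, |y i| ≤ μ * v i := by
  obtain ⟨j, hj⟩ := Finite.exists_max fun i => |y i| / v i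
  exact ⟨|y j| / v j, j, div_nonneg (abs_nonneg _) (hv j).le, (div_mul_cancel₀ _ (hv j).ne').symm,
    fun i => (div_le_iff₀ (hv i)).1 (hj i)⟩

theorem abs_mulVec_le [Fintype κ] {M B : Matrix ι κ ℝ} {y u : κ → ℝ}
    (hM : ∀ i j, |M i j| ≤ B i j) (hy : ∀ j, |y j| ≤ u j) (i : ι) :
    |(M *ᵥ y) i| ≤ (B *ᵥ u) i := by
  refine (Finset.abs_sum_le_sum_abs _ _).trans (Finset.sum_le_sum fun j _ => ?_)
  rw [abs_mul]
  exact mul_le_mul (hM i j) (hy j) (abs_nonneg _) ((abs_nonneg _).trans (hM i j))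

theorem Tensor.abs_mulVec_le [Fintype τ] {T B : Tensor ι κ τ} {y u : τ → ℝ}
    (hT : ∀ i j k, |T i j k| ≤ B i j k) (hy : ∀ k, |y k| ≤ u k) (i : ι) (j : κ) :
    |T.mulVec y i j| ≤ B.mulVec u i j :=
  IncExc.abs_mulVec_le (M := T i) (B := B i) (hT i) hy j

theorem Tensor.abs_quad_le [Fintype κ] {T B : Tensor ι κ κ} {y u : κ → ℝ}
    (hT : ∀ i j k, |T i j k| ≤ B i j k) (hy : ∀ k, |y k| ≤ u k) (i : ι) :
    |T.quad y i| ≤ B.quad u i :=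
  IncExc.abs_mulVec_le (Tensor.abs_mulVec_le hT hy) hy i

theorem Tensor.mul_mulVec [Fintype ι] [Fintype τ] (C : Matrix ι ι ℝ) (T : Tensor ι κ τ)
    (y : τ → ℝ) : C * T.mulVec y = (Tensor.matMul C T).mulVec y := by
  ext i j
  simp only [Matrix.mul_apply, Tensor.mulVec, Tensor.matMul, Matrix.of_apply, Finset.mul_sum,
    Finset.sum_mul, mul_assoc]
  exact Finset.sum_comm

theorem Tensor.mulVec_mulVec [Fintype τ] [Fintype τ'] (T : Tensor ι κ τ) (B : Matrix τ τ' ℝ)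
    (y : τ' → ℝ) : T.mulVec (B *ᵥ y) = (T.mulMat B).mulVec y := by
  ext i j
  exact congrFun (Matrix.mulVec_mulVec y (T i) B) j

theorem Tensor.mulVec_smul [Fintype τ] (T : Tensor ι κ τ) (μ : ℝ) (y : τ → ℝ) :
    T.mulVec (μ • y) = μ • T.mulVec y := by
  ext i j
  exact congrFun (Matrix.mulVec_smul (T i) μ y) j

theorem Tensor.quad_smul [Fintype κ] (T : Tensor ι κ κ) (μ : ℝ) (y : κ → ℝ) :
    T.quad (μ • y) = μ ^ 2 • T.quad y := by
  rw [Tensor.quad, Tensor.mulVec_smul, Matrix.smul_mulVec, Matrix.mulVec_smul, smul_smul, ← sq]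
  rfl

/-- If `|C J - 1| ≤ B` and `B v < v` for a positive vector `v`, then `C` is nonsingular. -/
theorem mulVec_eq_zero_of_abs_mul_sub_one_le [Fintype ι] [DecidableEq ι] [Nonempty ι]
    {C J B : Matrix ι ι ℝ} (h : ∀ i j, |(C * J - 1) i j| ≤ B i j) {v : ι → ℝ} (hv : ∀ j, 0 < v j)
    (hB : ∀ j, 0 < ((1 - B) *ᵥ v) j) {y : ι → ℝ} (hy : C *ᵥ y = 0) : y = 0 := by
  have hdet : (C * J).det ≠ 0 := by
    intro h0
    obtain ⟨x, hx0, hx⟩ := Matrix.exists_mulVec_eq_zero_iff.2 h0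
    -- A kernel vector satisfies `|x| = |(C J - 1) x| ≤ μ B v`; at the extremal index, `μ v j ≤ μ (B
    -- v) j` with `(B v) j < v j` forces `μ = 0`.
    obtain ⟨μ, j, hμ, hj, hle⟩ := exists_abs_le_mul hv x
    have h1 := abs_mulVec_le h (u := μ • v) hle j
    have h2 := hB j
    rw [Matrix.sub_mulVec, hx, Matrix.one_mulVec, zero_sub, Pi.neg_apply, abs_neg, hj,
      Matrix.mulVec_smul, Pi.smul_apply, smul_eq_mul] at h1
    rw [Matrix.sub_mulVec, Matrix.one_mulVec, Pi.sub_apply] at h2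
    have hμ0 : μ = 0 := by nlinarith
    refine hx0 (funext fun i => ?_)
    have := hle i
    rw [hμ0, zero_mul] at this
    exact abs_nonpos_iff.1 this
  by_contra hy0
  refine hdet ?_
  rw [Matrix.det_mul, Matrix.exists_mulVec_eq_zero_iff.1 ⟨y, hy0, hy⟩, zero_mul]

end Componentwise

/-! ### The scalar quadratics and their roots -/

section Quadratic

variable {n : ℕ} {w a b : Fin n → ℝ} {j : Fin n}

theorem lamE_pos (hw : 0 < w j) (ha : 0 < a j) : 0 < lamE w a b j := by
  unfold lamE; positivity

theorem lamI_nonneg (hw : 0 < w j) (ha : 0 < a j) (hb : 0 ≤ b j) : 0 ≤ lamI w a b j := by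
  have := lamE_pos (b := b) hw ha
  unfold lamI; positivity

/-- `λᵉ_j` and `λⁱ_j` are the roots of `a_j λ² - w_j λ + b_j`. -/
theorem quadratic_eq_mul (hw : 0 < w j) (ha : 0 < a j) (hD : 0 < disc w a b j) (t : ℝ) :
    b j - t * w j + t ^ 2 * a j = a j * ((t - lamE w a b j) * (t - lamI w a b j)) := by
  have hE := lamE_pos (b := b) hw ha
  have hroot : b j = lamE w a b j * w j - lamE w a b j ^ 2 * a j := by
    have hs := Real.sq_sqrt hD.le
    unfold lamE
    field_simp
    unfold disc at hs ⊢
    nlinarith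
  have hI : a j * lamI w a b j * lamE w a b j = b j := by
    unfold lamI; field_simp
  have hI' : a j * lamI w a b j = w j - lamE w a b j * a j := by
    refine mul_right_cancel₀ hE.ne' ?_
    rw [hI]; linear_combination hroot
  linear_combination -(t : ℝ) * hI' - hI + 2 * t * hI'

end Quadratic

/-! ### Slope expansions along the approximation curve and in `x` -/

section Slopes

variable {n m : ℕ}

theorem pt_sub_pt_eq_gSlope_mulVec {xhat : (Fin m → ℝ) → Fin n → ℝ} {p s : Fin m → ℝ}
    {Sx : Matrix (Fin n) (Fin m) ℝ} (h : IsSlope xhat p s Sx) :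
    pt (xhat s) s - pt (xhat p) p = gSlope Sx *ᵥ (s - p) := by
  rw [gSlope, Matrix.fromRows_mulVec, Matrix.one_mulVec, ← h]
  ext (i | i) <;> rfl

theorem mulVec_pt_sub_pt (M : Matrix (Fin n) (Fin n ⊕ Fin m) ℝ) (x c : Fin n → ℝ)
    (s : Fin m → ℝ) : M *ᵥ (pt x s - pt c s) = xCols M *ᵥ (x - c) := by
  ext i
  simp [Matrix.mulVec, dotProduct, pt, xCols]

theorem continuous_pt_left (s : Fin m → ℝ) : Continuous fun x : Fin n → ℝ => pt x s :=
  continuous_pi fun i => by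
    rcases i with i | i
    · exact continuous_apply i
    · exact continuous_const

/-- The product of a slope of `H` and a slope of `g` is a slope of `H ∘ g`; this transports the
residual bound from `p` to `s`. -/
theorem abs_apply_pt_le {H : (Fin n ⊕ Fin m → ℝ) → Fin n → ℝ} {xhat : (Fin m → ℝ) → Fin n → ℝ}
    {p s : Fin m → ℝ} {C : Matrix (Fin n) (Fin n) ℝ} {b : Fin n → ℝ}
    (hb : |C *ᵥ H (pt (xhat p) p)| ≤ b)
    {Sx : Matrix (Fin n) (Fin m) ℝ} (hSx : IsSlope xhat p s Sx)
    {SH : Matrix (Fin n) (Fin n ⊕ Fin m) ℝ}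
    (hSH : IsSlope H (pt (xhat p) p) (pt (xhat s) s) SH) (i : Fin n) :
    |(C *ᵥ H (pt (xhat s) s)) i| ≤
      (b + (absMat (C * SH) * absMat (gSlope Sx)) *ᵥ |s - p|) i := by
  have h1 : C *ᵥ H (pt (xhat s) s) =
      C *ᵥ H (pt (xhat p) p) + (C * SH) *ᵥ (gSlope Sx *ᵥ (s - p)) := by
    rw [← Matrix.mulVec_mulVec, ← pt_sub_pt_eq_gSlope_mulVec hSx, ← hSH, ← Matrix.mulVec_add,
      add_sub_cancel]
  rw [h1, ← Matrix.mulVec_mulVec |s - p|]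
  refine (abs_add_le _ _).trans (add_le_add (hb i) ?_)
  exact abs_mulVec_le (fun _ _ => le_rfl)
    (fun k => abs_mulVec_le (B := absMat (gSlope Sx)) (fun _ _ => le_rfl) (fun _ => le_rfl) k) i

/-- The same transport for the Jacobian defect; here `F` is later `jacX H`. -/
theorem abs_mul_sub_one_le {F : (Fin n ⊕ Fin m → ℝ) → Matrix (Fin n) (Fin n) ℝ}
    {xhat : (Fin m → ℝ) → Fin n → ℝ} {p s : Fin m → ℝ} {C B₀ : Matrix (Fin n) (Fin n) ℝ}
    (hB₀ : ∀ i j, |(C * F (pt (xhat p) p) - 1) i j| ≤ B₀ i j)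
    {Sx : Matrix (Fin n) (Fin m) ℝ} (hSx : IsSlope xhat p s Sx)
    {SF : Tensor (Fin n) (Fin n) (Fin n ⊕ Fin m)}
    (hSF : IsTensorSlope F (pt (xhat p) p) (pt (xhat s) s) SF) (i j : Fin n) :
    |(C * F (pt (xhat s) s) - 1) i j| ≤
      (B₀ + (Tensor.mulMat |Tensor.matMul C SF| (absMat (gSlope Sx))).mulVec |s - p|) i j := by
  have h1 : C * F (pt (xhat s) s) - 1 = (C * F (pt (xhat p) p) - 1) +
      (Tensor.matMul C SF).mulVec (gSlope Sx *ᵥ (s - p)) := by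
    rw [← Tensor.mul_mulVec, ← pt_sub_pt_eq_gSlope_mulVec hSx, ← hSF, mul_sub]
    abel
  rw [h1, ← Tensor.mulVec_mulVec]
  refine (abs_add_le _ _).trans (add_le_add (hB₀ i j) ?_)
  exact Tensor.abs_mulVec_le (fun _ _ _ => le_rfl)
    (fun k => abs_mulVec_le (B := absMat (gSlope Sx)) (fun _ _ => le_rfl) (fun _ => le_rfl) k) i j

/-- The second order slope expansion of the preconditioned function. -/
theorem mulVec_apply_pt_eq {H : (Fin n ⊕ Fin m → ℝ) → Fin n → ℝ} {D : Set (Fin n ⊕ Fin m → ℝ)}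
    {s : Fin m → ℝ} {c x : Fin n → ℝ} {T : Tensor (Fin n) (Fin n) (Fin n)}
    (hT : IsSecondSlopeX H D s c x T) (C : Matrix (Fin n) (Fin n) ℝ) :
    C *ᵥ H (pt x s) = C *ᵥ H (pt c s) + (C * jacX H D (pt c s)) *ᵥ (x - c) +
      (Tensor.matMul C T).quad (x - c) := by
  obtain ⟨M, hM, hcols⟩ := hT
  have h := congrArg (C *ᵥ ·) hM
  beta_reduce at h
  rw [Matrix.mulVec_sub, mulVec_pt_sub_pt, hcols, Matrix.mulVec_mulVec, mul_add,
    Tensor.mul_mulVec, Matrix.add_mulVec] at h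
  rw [Tensor.quad, add_assoc, ← h, add_sub_cancel]

end Slopes

end IncExc

/-! ### The inclusion and exclusion boxes -/

theorem mainTheorem2 {n m : ℕ} [NeZero n]
    -- the system `H : X × S → ℝⁿ`
    (X : Set (Fin n → ℝ)) (S : Set (Fin m → ℝ)) (H : (Fin n ⊕ Fin m → ℝ) → Fin n → ℝ)
    (hH : DifferentiableOn ℝ H (dom X S))
    -- the boxes `[xl, xu] ⊆ X` and `[sl, su] ⊆ S`, with the center `(z, p)`
    (xl xu : Fin n → ℝ) (hX : Set.Icc xl xu ⊆ X)
    (sl su : Fin m → ℝ) (hS : Set.Icc sl su ⊆ S)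
    (z : Fin n → ℝ) (hz : z ∈ Set.Icc xl xu) (p : Fin m → ℝ) (hp : p ∈ Set.Icc sl su)
    -- the approximation function
    (xhat : (Fin m → ℝ) → Fin n → ℝ) (hxhat : ContDiff ℝ 1 xhat) (hxhatp : xhat p = z)
    (hxhats : ∀ t ∈ Set.Icc sl su, xhat t ∈ Set.Icc xl xu)
    -- the preconditioner and the bounds at `(z, p)`
    (C : Matrix (Fin n) (Fin n) ℝ)
    (b : Fin n → ℝ) (hb : |C *ᵥ H (pt z p)| ≤ b)
    (B₀ : Matrix (Fin n) (Fin n) ℝ)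
    (hB₀ : ∀ i j, |(C * jacX H (dom X S) (pt z p) - 1) i j| ≤ B₀ i j)
    -- the parameter value `s`
    (s : Fin m → ℝ) (hs : s ∈ Set.Icc sl su) (hxs : xhat s ∈ interior (Set.Icc xl xu))
    -- first order slopes of `x̂`, of `H` and of `H'ₓ`
    (Sx : Matrix (Fin n) (Fin m) ℝ) (hSx : IsSlope xhat p s Sx)
    (SH : Matrix (Fin n) (Fin n ⊕ Fin m) ℝ) (hSH : IsSlope H (pt (xhat p) p) (pt (xhat s) s) SH)
    (SH' : Tensor (Fin n) (Fin n) (Fin n ⊕ Fin m))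
    (hSH' : IsTensorSlope (jacX H (dom X S)) (pt (xhat p) p) (pt (xhat s) s) SH')
    -- second order slopes with double center `(x̂(s), s)` at `(x, s)`
    (T : (Fin n → ℝ) → Tensor (Fin n) (Fin n) (Fin n))
    (hT : ∀ x ∈ Set.Icc xl xu, IsSecondSlopeX H (dom X S) s (xhat s) x (T x))
    -- the bounds at `s`
    (G₀ : Matrix (Fin n) (Fin m) ℝ) (hG₀ : G₀ = absMat (C * SH) * absMat (gSlope Sx))
    (A : Tensor (Fin n) (Fin n) (Fin m))
    (hA : A = Tensor.mulMat |Tensor.matMul C SH'| (absMat (gSlope Sx)))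
    (𝔟 : Fin n → ℝ) (h𝔟 : 𝔟 = b + G₀ *ᵥ |s - p|)
    (𝔅₀ : Matrix (Fin n) (Fin n) ℝ) (h𝔅₀ : 𝔅₀ = B₀ + A.mulVec |s - p|)
    (𝔅x : (Fin n → ℝ) → Tensor (Fin n) (Fin n) (Fin n))
    (h𝔅x : ∀ x ∈ Set.Icc xl xu, |Tensor.matMul C (T x)| ≤ 𝔅x x)
    (𝔅 : Tensor (Fin n) (Fin n) (Fin n)) (h𝔅 : ∀ x ∈ Set.Icc xl xu, 𝔅x x ≤ 𝔅)
    -- the scaling vector and the quantities derived from it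
    (v : Fin n → ℝ) (hv : ∀ j, 0 < v j)
    (𝔴 : Fin n → ℝ) (h𝔴 : 𝔴 = (1 - 𝔅₀) *ᵥ v)
    (𝔞 : Fin n → ℝ) (h𝔞 : 𝔞 = 𝔅.quad v)
    (h𝔴pos : ∀ j, 0 < 𝔴 j) (h𝔞ne : ∀ j, 𝔞 j ≠ 0)
    (hD : ∀ j, 0 < disc 𝔴 𝔞 𝔟 j)
    (le li : ℝ) (hle : le = lamEMin 𝔴 𝔞 𝔟) (hli : li = lamIMax 𝔴 𝔞 𝔟)
    (hlt : li < le)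
    (hbox : ∀ j, Set.Icc (xhat s j - li * v j) (xhat s j + li * v j) ⊆ Set.Icc (xl j) (xu j)) :
    (∃ x ∈ Set.Icc (xhat s - li • v) (xhat s + li • v), H (pt x s) = 0) ∧
      ∀ x ∈ interior (Set.Icc (xhat s - le • v) (xhat s + le • v) ∩ Set.Icc xl xu),
        H (pt x s) = 0 → x ∈ Set.Icc (xhat s - li • v) (xhat s + li • v) := by
  rw [hxhatp.symm] at hb hB₀
  set c := xhat s with hc
  have hcm : c ∈ Set.Icc xl xu := hxhats s hs
  have hbs : ∀ i, |(C *ᵥ H (pt c s)) i| ≤ 𝔟 i := by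
    subst h𝔟 hG₀
    exact abs_apply_pt_le hb hSx hSH
  have hBs : ∀ i j, |(C * jacX H (dom X S) (pt c s) - 1) i j| ≤ 𝔅₀ i j := by
    subst h𝔅₀ hA
    exact abs_mul_sub_one_le hB₀ hSx hSH'
  have hTs : ∀ x ∈ Set.Icc xl xu, ∀ i j k, |Tensor.matMul C (T x) i j k| ≤ 𝔅 i j k :=
    fun x hx i j k => (h𝔅x x hx i j k).trans (h𝔅 x hx i j k)
  have hb0 : ∀ j, 0 ≤ 𝔟 j := fun j => (abs_nonneg _).trans (hbs j)
  -- `𝔅` dominates an absolute value and `v > 0`, so `𝔞 ≥ 0`; the hypothesis `𝔞 j ≠ 0` makes it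
  -- strict.
  have ha0 : ∀ j, 0 < 𝔞 j := fun j => by
    refine lt_of_le_of_ne ?_ (h𝔞ne j).symm
    rw [h𝔞]
    exact (abs_nonneg _).trans (Tensor.abs_quad_le (hTs c hcm) (fun k => (abs_of_pos (hv k)).le) j)
  -- The central estimate, used at `t = li` for existence and at the weighted norm of `x - c` for
  -- exclusion.
  have hstep : ∀ x ∈ Set.Icc xl xu, ∀ t, (∀ j, |(x - c) j| ≤ t * v j) → ∀ j,
      |(x - C *ᵥ H (pt x s) - c) j| ≤
        t * v j + 𝔞 j * ((t - lamE 𝔴 𝔞 𝔟 j) * (t - lamI 𝔴 𝔞 𝔟 j)) := by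
    intro x hx t ht j
    rw [← quadratic_eq_mul (h𝔴pos j) (ha0 j) (hD j)]
    have hexp : x - C *ᵥ H (pt x s) - c = -(C *ᵥ H (pt c s) +
        (C * jacX H (dom X S) (pt c s) - 1) *ᵥ (x - c) +
          (Tensor.matMul C (T x)).quad (x - c)) := by
      rw [mulVec_apply_pt_eq (hT x hx) C, Matrix.sub_mulVec, Matrix.one_mulVec]
      abel
    have h1 := abs_mulVec_le hBs (u := t • v) ht j
    have h2 := Tensor.abs_quad_le (hTs x hx) (u := t • v) ht j
    rw [Matrix.mulVec_smul, Pi.smul_apply, smul_eq_mul] at h1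
    rw [Tensor.quad_smul, Pi.smul_apply, smul_eq_mul, ← h𝔞] at h2
    have hw : 𝔴 j = v j - (𝔅₀ *ᵥ v) j := by
      rw [h𝔴, Matrix.sub_mulVec, Matrix.one_mulVec, Pi.sub_apply]
    rw [hexp, Pi.neg_apply, abs_neg, hw]
    have h3 := (abs_add_le ((C *ᵥ H (pt c s)) j +
      ((C * jacX H (dom X S) (pt c s) - 1) *ᵥ (x - c)) j) ((Tensor.matMul C (T x)).quad (x - c) j))
    have h4 := abs_add_le ((C *ᵥ H (pt c s)) j)
      (((C * jacX H (dom X S) (pt c s) - 1) *ᵥ (x - c)) j)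
    have h5 := hbs j
    simp only [Pi.add_apply]
    linarith
  have hIle : ∀ j, lamI 𝔴 𝔞 𝔟 j ≤ li := fun j => by
    rw [hli]; exact Finset.le_sup' _ (Finset.mem_univ j)
  have hEle : ∀ j, le ≤ lamE 𝔴 𝔞 𝔟 j := fun j => by
    rw [hle]; exact Finset.inf'_le _ (Finset.mem_univ j)
  have hmem : ∀ (x : Fin n → ℝ) (t : ℝ),
      x ∈ Set.Icc (c - t • v) (c + t • v) ↔ ∀ j, |(x - c) j| ≤ t * v j := by
    intro x t
    simp only [Set.mem_Icc, Pi.le_def, ← forall_and, Pi.sub_apply, Pi.add_apply, Pi.smul_apply,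
      smul_eq_mul, abs_le]
    exact forall_congr' fun j => by constructor <;> rintro ⟨h1, h2⟩ <;> constructor <;> linarith
  have hC : ∀ y, C *ᵥ y = 0 → y = 0 := fun y hy =>
    mulVec_eq_zero_of_abs_mul_sub_one_le hBs hv (fun j => h𝔴 ▸ h𝔴pos j) hy
  constructor
  · have hli0 : 0 ≤ li := (lamI_nonneg (h𝔴pos 0) (ha0 0) (hb0 0)).trans (hIle 0)
    have hsub : Set.Icc (c - li • v) (c + li • v) ⊆ Set.Icc xl xu := fun x hx =>
      ⟨fun j => (hbox j ⟨hx.1 j, hx.2 j⟩).1, fun j => (hbox j ⟨hx.1 j, hx.2 j⟩).2⟩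
    have hcont : ContinuousOn (fun x => x - C *ᵥ H (pt x s))
        (Set.Icc (c - li • v) (c + li • v)) := by
      refine continuousOn_id.sub
        ((Continuous.matrix_mulVec continuous_const continuous_id).comp_continuousOn ?_)
      exact hH.continuousOn.comp (continuous_pt_left s).continuousOn
        fun x hx => ⟨hX (hsub hx), hS hs⟩
    obtain ⟨x, hx, hfix⟩ := exists_fixedPoint_Icc (fun j => by
        have := mul_nonneg hli0 (hv j).le
        simp only [Pi.sub_apply, Pi.add_apply, Pi.smul_apply, smul_eq_mul]
        linarith) hcont fun x hx => (hmem _ _).2 fun j =>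
      (hstep x (hsub hx) li ((hmem _ _).1 hx) j).trans <| by
        have h1 : (li - lamE 𝔴 𝔞 𝔟 j) * (li - lamI 𝔴 𝔞 𝔟 j) ≤ 0 :=
          mul_nonpos_of_nonpos_of_nonneg (by linarith [hEle j]) (by linarith [hIle j])
        linarith [mul_nonpos_of_nonneg_of_nonpos (ha0 j).le h1]
    exact ⟨x, hx, hC _ (sub_eq_self.1 hfix)⟩
  · intro x hx hx0
    obtain ⟨t, j, -, hj, ht⟩ := exists_abs_le_mul hv (x - c)
    have hlt' : t < le := by
      -- Interiority in the exclusion box is what makes `t < le` strict.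
      have hint := interior_mono Set.inter_subset_left hx
      rw [← Set.pi_univ_Icc, interior_pi_set Set.finite_univ] at hint
      have hxj := hint j (Set.mem_univ j)
      simp only [interior_Icc, Pi.sub_apply, Pi.add_apply, Pi.smul_apply, smul_eq_mul, Set.mem_Ioo] at hxj
      have : t * v j < le * v j := by
        rw [← hj, abs_lt, Pi.sub_apply]
        constructor <;> linarith
      exact lt_of_mul_lt_mul_right this (hv j).le
    have h1 := hstep x (interior_subset hx).2 t ht j
    rw [hx0, Matrix.mulVec_zero, sub_zero, hj] at h1
    -- At the extremal index and at a zero, the left side of `hstep` is exactly `t * v j`, which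
    -- cancels.
    have h2 : 0 ≤ (t - lamE 𝔴 𝔞 𝔟 j) * (t - lamI 𝔴 𝔞 𝔟 j) :=
      nonneg_of_mul_nonneg_right (by linarith) (ha0 j)
    have h3 : t ≤ li := by
      have : t - lamI 𝔴 𝔞 𝔟 j ≤ 0 := by
        by_contra! h
        have := hEle j
        nlinarith
      linarith [hIle j]
    exact (hmem _ _).2 fun i => (ht i).trans (mul_le_mul_of_nonneg_right h3 (hv i).le)
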